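/- Let $R$ be a commutative ring with $1$, and let $A$, $B$, $C$ be flat $R$-group schemes, regarded as sheaves of groups on the big fppf site of $\operatorname{Spec} R$. Let $$1 \to A \xrightarrow{i} B \xrightarrow{\pi} C \to 1$$ be a central exact sequence, i.e. an exact sequence of fppf sheaves of groups ($i$ identifies $A$ with the kernel of $\pi$, and every section of $C$ lifts to $B$ fppf-locally) in which $i(A)$ lies in the centre of $B$. For a sheaf of groups $G$ let $H^1_{\mathrm{fl}}(R,G)$ be the set of isomorphism classes of (right) $G$-torsors for the fppf topology, that is, of sheaves $P$ with a right $G$-action which have sections fppf-locally and for which $P\times G\to P\times P$, $(p,g)\mapsto(p,pg)$, is an isomorphism. For an $A$-torsor $P$ and a sheaf $X$ with a left $A$-action, let $P\wedge^A X$ be the quotient sheaf of $P\times X$ by $(p,x)\sim(pa,a^{-1}x)$. Define: * the push-forward $i_*\colon H^1_{\mathrm{fl}}(R,A)\to H^1_{\mathrm{fl}}(R,B)$, $[P]\mapsto[P\wedge^A B]$, where $A$ acts on $B$ by left translations through $i$; * for an $A$-torsor $P$, the twist ${}^P B=P\wedge^A B$, where now $A$ acts on $B$ by conjugation through $i$,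 with the quotient map $\pi\colon{}^P B\to C$, $[p,b]\mapsto\pi(b)$; * the action of $C(R)$ on $H^1_{\mathrm{fl}}(R,A)$: for $c\in C(R)$ let $X=\pi^{-1}(c)\subseteq B$, an $A$-bitorsor under left and right translations through $i$, and put $c*[P]=[P\wedge^A X]$. Then the following are equivalent: 1. the push-forward map $i_*\colon H^1_{\mathrm{fl}}(R,A)\to H^1_{\mathrm{fl}}(R,B)$ is injective; 2. the quotient map $\pi\colon{}^P B(R)\to C(R)$ is surjective for every $A$-torsor $P$; 3. the $C(R)$-action on $H^1_{\mathrm{fl}}(R,A)$ is trivial, i.e. $c*[P]=[P]$ for all $c\in C(R)$ and all $[P]\in H^1_{\mathrm{fl}}(R,A)$. -/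

import Mathlib

open CategoryTheory Opposite

universe v u

namespace FlatCoh

/-! ## Torsors over a site and contracted products -/

section Site

variable {𝒞 : Type u} [Category.{v} 𝒞] {J : GrothendieckTopology 𝒞}

/-- The sheaf of sets underlying a sheaf of groups. -/
noncomputable abbrev setSheaf (G : Sheaf J GrpCat.{max u v}) : Sheaf J (Type (max u v)) :=
  (sheafCompose J (forget GrpCat)).obj G

/-- A section of the underlying sheaf of sets, viewed as an element of the group of sections. -/
abbrev grp {G : Sheaf J GrpCat.{max u v}} {U : 𝒞ᵒᵖ} (b : (setSheaf G).obj.obj U) :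
    G.obj.obj U := b

/-- A (right) torsor under a sheaf of groups `G`: a sheaf of sets `P` which has sections locally,
with a right action of `G` for which `P × G → P × P`, `(p, g) ↦ (p, p g)` is bijective. -/
structure Torsor (G : Sheaf J GrpCat.{max u v}) where
  carrier : Sheaf J (Type (max u v))
  act : ∀ {U : 𝒞ᵒᵖ}, carrier.obj.obj U → G.obj.obj U → carrier.obj.obj U
  act_one : ∀ {U : 𝒞ᵒᵖ} (p : carrier.obj.obj U), act p 1 = p
  act_mul : ∀ {U : 𝒞ᵒᵖ} (p : carrier.obj.obj U) (g h : G.obj.obj U),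
    act p (g * h) = act (act p g) h
  map_act : ∀ {U V : 𝒞ᵒᵖ} (f : U ⟶ V) (p : carrier.obj.obj U) (g : G.obj.obj U),
    carrier.obj.map f (act p g) = act (carrier.obj.map f p) (G.obj.map f g)
  bijective : ∀ U : 𝒞ᵒᵖ, Function.Bijective
    (fun x : carrier.obj.obj U × G.obj.obj U => (x.1, act x.1 x.2))
  locally_nonempty : ∀ U : 𝒞, ∃ S ∈ J U, ∀ ⦃V : 𝒞⦄ (f : V ⟶ U), S f →
    Nonempty (carrier.obj.obj (op V))

/-- Isomorphism of `G`-torsors: a `G`-equivariant isomorphism of sheaves. -/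
def Torsor.Isomorphic {G : Sheaf J GrpCat.{max u v}} (P Q : Torsor G) : Prop :=
  ∃ φ : P.carrier ≅ Q.carrier, ∀ (U : 𝒞ᵒᵖ) (p : P.carrier.obj.obj U) (g : G.obj.obj U),
    φ.hom.hom.app U (P.act p g) = Q.act (φ.hom.hom.app U p) g

theorem Torsor.isomorphic_equivalence (G : Sheaf J GrpCat.{max u v}) :
    Equivalence (Torsor.Isomorphic (G := G)) where
  refl P := ⟨Iso.refl _, fun U p g => rfl⟩
  symm := by
    rintro P Q ⟨φ, h⟩
    have e1 : ∀ U x, φ.inv.hom.app U (φ.hom.hom.app U x) = x := fun U x => by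
      have := congr(($(φ.hom_inv_id)).hom.app U x)
      exact this
    have e2 : ∀ U x, φ.hom.hom.app U (φ.inv.hom.app U x) = x := fun U x => by
      have := congr(($(φ.inv_hom_id)).hom.app U x)
      exact this
    refine ⟨φ.symm, fun U q g => ?_⟩
    change φ.inv.hom.app U (Q.act q g) = P.act (φ.inv.hom.app U q) g
    rw [← e1 U (P.act _ g), h, e2]
  trans := by
    rintro P Q T ⟨φ, h⟩ ⟨ψ, k⟩
    refine ⟨φ ≪≫ ψ, fun U p g => ?_⟩
    change ψ.hom.hom.app U (φ.hom.hom.app U (P.act p g)) = _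
    rw [h, k]
    rfl

instance torsorSetoid (G : Sheaf J GrpCat.{max u v}) : Setoid (Torsor G) :=
  ⟨Torsor.Isomorphic, Torsor.isomorphic_equivalence G⟩

/-- `H¹(G)`: the set of isomorphism classes of `G`-torsors. -/
def H1 (G : Sheaf J GrpCat.{max u v}) : Type _ := Quotient (torsorSetoid G)

/-- A left action of a sheaf of groups on a sheaf of sets. -/
structure LeftAction (A : Sheaf J GrpCat.{max u v}) (X : Sheaf J (Type (max u v))) where
  smul : ∀ {U : 𝒞ᵒᵖ}, A.obj.obj U → X.obj.obj U → X.obj.obj U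
  one_smul : ∀ {U : 𝒞ᵒᵖ} (x : X.obj.obj U), smul 1 x = x
  mul_smul : ∀ {U : 𝒞ᵒᵖ} (a b : A.obj.obj U) (x : X.obj.obj U),
    smul (a * b) x = smul a (smul b x)
  map_smul : ∀ {U V : 𝒞ᵒᵖ} (f : U ⟶ V) (a : A.obj.obj U) (x : X.obj.obj U),
    X.obj.map f (smul a x) = smul (A.obj.map f a) (X.obj.map f x)

variable {A : Sheaf J GrpCat.{max u v}}

/-- The relation `(p, x) ∼ (p a, a⁻¹ x)` on `P(U) × X(U)`. -/
def contractSetoid (P : Torsor A) {X : Sheaf J (Type (max u v))} (L : LeftAction A X)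
    (U : 𝒞ᵒᵖ) : Setoid (P.carrier.obj.obj U × X.obj.obj U) where
  r z w := ∃ a : A.obj.obj U, w = (P.act z.1 a, L.smul a⁻¹ z.2)
  iseqv :=
    { refl := fun z => ⟨1, by rw [P.act_one, inv_one, L.one_smul]⟩
      symm := by
        rintro z w ⟨a, rfl⟩
        refine ⟨a⁻¹, ?_⟩
        dsimp only
        rw [← P.act_mul, ← L.mul_smul]
        simp [P.act_one, L.one_smul]
      trans := by
        rintro z w y ⟨a, rfl⟩ ⟨b, rfl⟩
        refine ⟨a * b, ?_⟩
        dsimp only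
        rw [P.act_mul, ← L.mul_smul, mul_inv_rev] }

/-- The quotient presheaf `U ↦ (P(U) × X(U)) / A(U)`. -/
def contractPresheaf (P : Torsor A) {X : Sheaf J (Type (max u v))} (L : LeftAction A X) :
    𝒞ᵒᵖ ⥤ Type (max u v) where
  obj U := Quotient (contractSetoid P L U)
  map {U V} f := TypeCat.ofHom (Quotient.map' (s₁ := contractSetoid P L U)
    (s₂ := contractSetoid P L V)
    (fun z => (P.carrier.obj.map f z.1, X.obj.map f z.2)) (by
      rintro z w ⟨a, rfl⟩
      refine ⟨A.obj.map f a, ?_⟩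
      dsimp only
      rw [P.map_act, L.map_smul, map_inv]))
  map_id U := by
    ext z
    induction z using Quotient.inductionOn' with
    | h z => simp
  map_comp f g := by
    ext z
    induction z using Quotient.inductionOn' with
    | h z => simp

/-- The class of `(p, x)` in the quotient presheaf. -/
def contractMk (P : Torsor A) {X : Sheaf J (Type (max u v))} (L : LeftAction A X) {U : 𝒞ᵒᵖ}
    (p : P.carrier.obj.obj U) (x : X.obj.obj U) : (contractPresheaf P L).obj U :=
  Quotient.mk (contractSetoid P L U) (p, x)

/-- The contracted product `P ∧^A X`, i.e. the quotient sheaf of `P × X` by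
`(p, x) ∼ (p a, a⁻¹ x)`. -/
noncomputable def contract (P : Torsor A) {X : Sheaf J (Type (max u v))} (L : LeftAction A X) :
    Sheaf J (Type (max u v)) :=
  (presheafToSheaf J (Type (max u v))).obj (contractPresheaf P L)

/-- The canonical map from the quotient presheaf to the quotient sheaf. -/
noncomputable def toContract (P : Torsor A) {X : Sheaf J (Type (max u v))} (L : LeftAction A X) :
    contractPresheaf P L ⟶ (contract P L).obj :=
  toSheafify J (contractPresheaf P L)

instance (P : Torsor A) {X : Sheaf J (Type (max u v))} (L : LeftAction A X) :
    Presheaf.IsLocallyInjective J (toContract P L) :=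
  inferInstanceAs (Presheaf.IsLocallyInjective J (toSheafify J (contractPresheaf P L)))

instance (P : Torsor A) {X : Sheaf J (Type (max u v))} (L : LeftAction A X) :
    Presheaf.IsLocallySurjective J (toContract P L) :=
  inferInstanceAs (Presheaf.IsLocallySurjective J (toSheafify J (contractPresheaf P L)))

/-- The class `[p, x]` as a section of `P ∧^A X`. -/
noncomputable def cls (P : Torsor A) {X : Sheaf J (Type (max u v))} (L : LeftAction A X)
    {U : 𝒞ᵒᵖ} (p : P.carrier.obj.obj U) (x : X.obj.obj U) : (contract P L).obj.obj U :=
  (toContract P L).app U (contractMk P L p x)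

theorem sheaf_ext (F : Sheaf J (Type (max u v))) {U : 𝒞} {S : Sieve U} (hS : S ∈ J U)
    {s t : F.obj.obj (op U)}
    (h : ∀ ⦃V : 𝒞⦄ (f : V ⟶ U), S f → F.obj.map f.op s = F.obj.map f.op t) : s = t :=
  (((isSheaf_iff_isSheaf_of_type J _).1 F.2).isSeparated S hS).ext h

theorem map_cls (P : Torsor A) {X : Sheaf J (Type (max u v))} (L : LeftAction A X)
    {U V : 𝒞ᵒᵖ} (f : U ⟶ V) (p : P.carrier.obj.obj U) (x : X.obj.obj U) :
    (contract P L).obj.map f (cls P L p x) =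
      cls P L (P.carrier.obj.map f p) (X.obj.map f x) :=
  (NatTrans.naturality_apply (toContract P L) f (contractMk P L p x)).symm

theorem cls_act_smul (P : Torsor A) {X : Sheaf J (Type (max u v))} (L : LeftAction A X)
    {U : 𝒞ᵒᵖ} (p : P.carrier.obj.obj U) (a : A.obj.obj U) (x : X.obj.obj U) :
    cls P L (P.act p a) x = cls P L p (L.smul a x) := by
  refine congrArg ((toContract P L).app U) (Quotient.sound (s := contractSetoid P L U) ⟨a⁻¹, ?_⟩)
  dsimp only
  rw [← P.act_mul, mul_inv_cancel, P.act_one, inv_inv]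

theorem locally_cls (P : Torsor A) {X : Sheaf J (Type (max u v))} (L : LeftAction A X)
    {U : 𝒞} (q : (contract P L).obj.obj (op U)) :
    ∃ S ∈ J U, ∀ ⦃V : 𝒞⦄ (f : V ⟶ U), S f → ∃ (p : P.carrier.obj.obj (op V))
      (x : X.obj.obj (op V)), (contract P L).obj.map f.op q = cls P L p x := by
  refine ⟨_, Presheaf.imageSieve_mem J (toContract P L) q, fun V f hf => ?_⟩
  obtain ⟨z, hz⟩ := hf
  induction z using Quotient.inductionOn' with
  | h z => exact ⟨z.1, z.2, hz.symm⟩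

theorem cls_eq_locally (P : Torsor A) {X : Sheaf J (Type (max u v))} (L : LeftAction A X)
    {U : 𝒞} {p p' : P.carrier.obj.obj (op U)} {x x' : X.obj.obj (op U)}
    (h : cls P L p x = cls P L p' x') :
    ∃ S ∈ J U, ∀ ⦃V : 𝒞⦄ (f : V ⟶ U), S f → ∃ a : A.obj.obj (op V),
      P.carrier.obj.map f.op p' = P.act (P.carrier.obj.map f.op p) a ∧
      X.obj.map f.op x' = L.smul a⁻¹ (X.obj.map f.op x) := by
  refine ⟨_, Presheaf.equalizerSieve_mem J (toContract P L) _ _ h, fun V f hf => ?_⟩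
  obtain ⟨a, ha⟩ := Quotient.exact (s := contractSetoid P L (op V)) hf
  exact ⟨a, congrArg Prod.fst ha, congrArg Prod.snd ha⟩

/-- A left action of `A` on a right `H`-torsor `X` commuting with the action of `H`. -/
structure CommutingAction (A : Sheaf J GrpCat.{max u v}) {H : Sheaf J GrpCat.{max u v}}
    (X : Torsor H) extends LeftAction A X.carrier where
  smul_act : ∀ {U : 𝒞ᵒᵖ} (a : A.obj.obj U) (x : X.carrier.obj.obj U) (h : H.obj.obj U),
    smul a (X.act x h) = X.act (smul a x) h

section ContractTorsor

variable {H : Sheaf J GrpCat.{max u v}} (P : Torsor A) {X : Torsor H} (L : CommutingAction A X)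

theorem cls_act_congr {U : 𝒞} {p p' : P.carrier.obj.obj (op U)}
    {x x' : X.carrier.obj.obj (op U)}
    (e : cls P L.toLeftAction p x = cls P L.toLeftAction p' x') (h : H.obj.obj (op U)) :
    cls P L.toLeftAction p (X.act x h) = cls P L.toLeftAction p' (X.act x' h) := by
  obtain ⟨S, hS, hS'⟩ := cls_eq_locally P L.toLeftAction e
  refine sheaf_ext _ hS fun V f hf => ?_
  obtain ⟨a, h1, h2⟩ := hS' f hf
  rw [map_cls, map_cls, X.map_act, X.map_act, h1, h2, cls_act_smul, ← L.smul_act, ← L.mul_smul,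
    mul_inv_cancel, L.one_smul]

/-- `q'` is the translate of the section `q` of `P ∧^A X` by `h`: locally `q = [p, x]` and
`q' = [p, x h]`. -/
def IsTranslate {U : 𝒞} (q : (contract P L.toLeftAction).obj.obj (op U)) (h : H.obj.obj (op U))
    (q' : (contract P L.toLeftAction).obj.obj (op U)) : Prop :=
  ∀ ⦃V : 𝒞⦄ (f : V ⟶ U) (p : P.carrier.obj.obj (op V)) (x : X.carrier.obj.obj (op V)),
    (contract P L.toLeftAction).obj.map f.op q = cls P L.toLeftAction p x →
    (contract P L.toLeftAction).obj.map f.op q' =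
      cls P L.toLeftAction p (X.act x (H.obj.map f.op h))

variable {P L}

theorem IsTranslate.unique {U : 𝒞} {q q₁ q₂ : (contract P L.toLeftAction).obj.obj (op U)}
    {h : H.obj.obj (op U)} (h₁ : IsTranslate P L q h q₁) (h₂ : IsTranslate P L q h q₂) :
    q₁ = q₂ := by
  obtain ⟨S, hS, hS'⟩ := locally_cls P L.toLeftAction q
  refine sheaf_ext _ hS fun V f hf => ?_
  obtain ⟨p, x, e⟩ := hS' f hf
  rw [h₁ f p x e, h₂ f p x e]

theorem IsTranslate.map {U V : 𝒞} (f : V ⟶ U)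
    {q q' : (contract P L.toLeftAction).obj.obj (op U)}
    {h : H.obj.obj (op U)} (k : IsTranslate P L q h q') :
    IsTranslate P L ((contract P L.toLeftAction).obj.map f.op q) (H.obj.map f.op h)
      ((contract P L.toLeftAction).obj.map f.op q') := by
  intro W g p x e
  have := k (g ≫ f) p x (by simpa using e)
  simpa using this

theorem isTranslate_cls {U : 𝒞} (p : P.carrier.obj.obj (op U)) (x : X.carrier.obj.obj (op U))
    (h : H.obj.obj (op U)) :
    IsTranslate P L (cls P L.toLeftAction p x) h (cls P L.toLeftAction p (X.act x h)) := by
  intro V f p' x' e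
  rw [map_cls] at e ⊢
  rw [X.map_act]
  exact cls_act_congr P L e _

theorem IsTranslate.of_locally {U : 𝒞} {q q' : (contract P L.toLeftAction).obj.obj (op U)}
    {h : H.obj.obj (op U)} {S : Sieve U} (hS : S ∈ J U)
    (k : ∀ ⦃V : 𝒞⦄ (f : V ⟶ U), S f →
      IsTranslate P L ((contract P L.toLeftAction).obj.map f.op q) (H.obj.map f.op h)
        ((contract P L.toLeftAction).obj.map f.op q')) :
    IsTranslate P L q h q' := by
  intro V f p x e
  refine sheaf_ext _ (J.pullback_stable f hS) fun W g hg => ?_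
  have := k (g ≫ f) hg (𝟙 W) (P.carrier.obj.map g.op p) (X.carrier.obj.map g.op x)
    (by rw [← map_cls, ← e]; simp)
  rw [map_cls, X.map_act]
  simpa using this

variable (P L)

theorem exists_isTranslate {U : 𝒞} (q : (contract P L.toLeftAction).obj.obj (op U))
    (h : H.obj.obj (op U)) : ∃ q', IsTranslate P L q h q' := by
  obtain ⟨S, hS, hS'⟩ := locally_cls P L.toLeftAction q
  have key : ∀ (V : 𝒞) (f : V ⟶ U), S f →
      ∃ q', IsTranslate P L ((contract P L.toLeftAction).obj.map f.op q) (H.obj.map f.op h) q' := by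
    intro V f hf
    obtain ⟨p, x, e⟩ := hS' f hf
    exact ⟨_, e ▸ isTranslate_cls p x (H.obj.map f.op h)⟩
  choose y hy using key
  have hc : Presieve.FamilyOfElements.Compatible (P := (contract P L.toLeftAction).obj)
      (R := S.arrows) (fun V f hf => y V f hf) := by
    intro V₁ V₂ W g₁ g₂ f₁ f₂ h₁ h₂ e
    have t₁ := (hy _ f₁ h₁).map g₁
    have t₂ := (hy _ f₂ h₂).map g₂
    simp only [← Functor.map_comp_apply, ← op_comp] at t₁ t₂
    rw [← e] at t₂
    exact t₁.unique t₂
  obtain ⟨q', hq', -⟩ :=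
    ((isSheaf_iff_isSheaf_of_type J _).1 (contract P L.toLeftAction).2) S hS _ hc
  refine ⟨q', IsTranslate.of_locally hS fun V f hf => ?_⟩
  rw [hq' f hf]
  exact hy V f hf

/-- The right action of `H` on `P ∧^A X`, given by `[p, x] h = [p, x h]`. -/
noncomputable def contractAct {U : 𝒞ᵒᵖ} (q : (contract P L.toLeftAction).obj.obj U)
    (h : H.obj.obj U) : (contract P L.toLeftAction).obj.obj U :=
  (exists_isTranslate P L (U := U.unop) q h).choose

theorem contractAct_spec {U : 𝒞} (q : (contract P L.toLeftAction).obj.obj (op U))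
    (h : H.obj.obj (op U)) : IsTranslate P L q h (contractAct P L q h) :=
  (exists_isTranslate P L q h).choose_spec

theorem cls_contractAct {U : 𝒞ᵒᵖ} (p : P.carrier.obj.obj U) (x : X.carrier.obj.obj U)
    (h : H.obj.obj U) :
    contractAct P L (cls P L.toLeftAction p x) h = cls P L.toLeftAction p (X.act x h) :=
  (contractAct_spec P L (U := U.unop) _ h).unique (isTranslate_cls p x h)

theorem map_contractAct {U V : 𝒞ᵒᵖ} (f : U ⟶ V) (q : (contract P L.toLeftAction).obj.obj U)
    (h : H.obj.obj U) :
    (contract P L.toLeftAction).obj.map f (contractAct P L q h) =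
      contractAct P L ((contract P L.toLeftAction).obj.map f q) (H.obj.map f h) :=
  ((contractAct_spec P L (U := U.unop) q h).map f.unop).unique
    (contractAct_spec P L (U := V.unop) _ _)

theorem Torsor.eq_of_act_eq {G : Sheaf J GrpCat.{max u v}} (T : Torsor G) {U : 𝒞ᵒᵖ}
    {p : T.carrier.obj.obj U} {g h : G.obj.obj U} (e : T.act p g = T.act p h) : g = h :=
  congrArg Prod.snd ((T.bijective U).1 (a₁ := (p, g)) (a₂ := (p, h)) (Prod.ext rfl e))

theorem Torsor.exists_act_eq {G : Sheaf J GrpCat.{max u v}} (T : Torsor G) {U : 𝒞ᵒᵖ}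
    (p q : T.carrier.obj.obj U) : ∃ g, T.act p g = q := by
  obtain ⟨⟨p', g⟩, e⟩ := (T.bijective U).2 (p, q)
  have e₁ : p' = p := congrArg Prod.fst e
  have e₂ : T.act p' g = q := congrArg Prod.snd e
  exact ⟨g, e₁ ▸ e₂⟩

theorem contractAct_injective {U : 𝒞} (q : (contract P L.toLeftAction).obj.obj (op U))
    {g h : H.obj.obj (op U)} (e : contractAct P L q g = contractAct P L q h) : g = h := by
  obtain ⟨S, hS, hS'⟩ := locally_cls P L.toLeftAction q
  refine sheaf_ext (setSheaf H) hS fun V f hf => ?_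
  obtain ⟨p, x, ex⟩ := hS' f hf
  have e' := congrArg ((contract P L.toLeftAction).obj.map f.op) e
  rw [map_contractAct, map_contractAct, ex, cls_contractAct, cls_contractAct] at e'
  obtain ⟨T, hT, hT'⟩ := cls_eq_locally P L.toLeftAction e'
  refine sheaf_ext (setSheaf H) hT fun W k hk => ?_
  obtain ⟨a, h1, h2⟩ := hT' k hk
  have ha : a = 1 := P.eq_of_act_eq (h1.symm.trans (P.act_one _).symm)
  rw [ha, inv_one, L.one_smul, X.map_act, X.map_act] at h2
  exact (X.eq_of_act_eq h2).symm

theorem exists_contractAct_eq {U : 𝒞} (q q' : (contract P L.toLeftAction).obj.obj (op U)) :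
    ∃ h, contractAct P L q h = q' := by
  obtain ⟨S, hS, hS'⟩ := locally_cls P L.toLeftAction q
  obtain ⟨T, hT, hT'⟩ := locally_cls P L.toLeftAction q'
  have key : ∀ (V : 𝒞) (f : V ⟶ U), (S ⊓ T) f → ∃ h,
      contractAct P L ((contract P L.toLeftAction).obj.map f.op q) h =
        (contract P L.toLeftAction).obj.map f.op q' := by
    intro V f hf
    obtain ⟨p, x, e⟩ := hS' f hf.1
    obtain ⟨p', x', e'⟩ := hT' f hf.2
    obtain ⟨a, rfl⟩ := P.exists_act_eq p p'
    obtain ⟨h, hh⟩ := X.exists_act_eq x (L.smul a x')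
    refine ⟨h, ?_⟩
    rw [e, e', cls_contractAct, hh, cls_act_smul]
  choose y hy using key
  have hST : S ⊓ T ∈ J U := J.intersection_covering hS hT
  have hc : Presieve.FamilyOfElements.Compatible (P := (setSheaf H).obj)
      (R := (S ⊓ T).arrows) (fun V f hf => y V f hf) := by
    intro V₁ V₂ W g₁ g₂ f₁ f₂ h₁ h₂ e
    have t₁ := congrArg ((contract P L.toLeftAction).obj.map g₁.op) (hy _ f₁ h₁)
    have t₂ := congrArg ((contract P L.toLeftAction).obj.map g₂.op) (hy _ f₂ h₂)
    rw [map_contractAct] at t₁ t₂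
    simp only [← Functor.map_comp_apply, ← op_comp] at t₁ t₂
    rw [← e, ← t₁] at t₂
    exact (contractAct_injective P L _ t₂).symm
  obtain ⟨h, hh⟩ : ∃ h : H.obj.obj (op U), ∀ (V : 𝒞) (f : V ⟶ U) (hf : (S ⊓ T) f),
      H.obj.map f.op h = y V f hf := by
    obtain ⟨h, hh, -⟩ :=
      ((isSheaf_iff_isSheaf_of_type J _).1 (setSheaf H).2) _ hST _ hc
    exact ⟨h, hh⟩
  refine ⟨h, sheaf_ext _ hST fun V f hf => ?_⟩
  rw [map_contractAct, hh V f hf, hy]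

/-- The right `H`-torsor `P ∧^A X`. -/
noncomputable def contractTorsor : Torsor H where
  carrier := contract P L.toLeftAction
  act := contractAct P L
  act_one {U} q := by
    refine (contractAct_spec P L (U := U.unop) q 1).unique fun V f p x e => ?_
    rw [map_one, X.act_one]
    exact e
  act_mul {U} q g h := by
    refine (contractAct_spec P L (U := U.unop) q (g * h)).unique fun V f p x e => ?_
    have : (contract P L.toLeftAction).obj.map f.op (contractAct P L (contractAct P L q g) h) =
      contractAct P L (contractAct P L ((contract P L.toLeftAction).obj.map f.op q)
        (H.obj.map f.op g)) (H.obj.map f.op h) := by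
      rw [← map_contractAct, ← map_contractAct]
    refine this.trans ?_
    rw [e, cls_contractAct, cls_contractAct, map_mul, X.act_mul]
  map_act f q h := map_contractAct P L f q h
  bijective U := by
    constructor
    · rintro ⟨q, g⟩ ⟨q', g'⟩ e
      obtain ⟨rfl, e⟩ := Prod.mk.inj e
      exact Prod.ext rfl (contractAct_injective P L (U := U.unop) q e)
    · rintro ⟨q, q'⟩
      obtain ⟨h, hh⟩ := exists_contractAct_eq P L (U := U.unop) q q'
      exact ⟨(q, h), Prod.ext rfl hh⟩
  locally_nonempty U := by
    obtain ⟨S, hS, hS'⟩ := P.locally_nonempty U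
    obtain ⟨T, hT, hT'⟩ := X.locally_nonempty U
    refine ⟨S ⊓ T, J.intersection_covering hS hT, fun V f hf => ?_⟩
    obtain ⟨p⟩ := hS' f hf.1
    obtain ⟨x⟩ := hT' f hf.2
    exact ⟨cls P L.toLeftAction p x⟩

/-- The map `[p, x] ↦ [φ p, x]` of quotient presheaves for an equivariant `φ : P ⟶ P'`. -/
def contractPresheafMap {P P' : Torsor A} {X : Sheaf J (Type (max u v))} (L : LeftAction A X)
    (φ : P.carrier ⟶ P'.carrier)
    (hφ : ∀ (U : 𝒞ᵒᵖ) (p : P.carrier.obj.obj U) (a : A.obj.obj U),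
      φ.hom.app U (P.act p a) = P'.act (φ.hom.app U p) a) :
    contractPresheaf P L ⟶ contractPresheaf P' L where
  app U := TypeCat.ofHom (Quotient.map' (s₁ := contractSetoid P L U)
    (s₂ := contractSetoid P' L U) (fun z => (φ.hom.app U z.1, z.2)) (by
      rintro z w ⟨a, rfl⟩
      exact ⟨a, by dsimp only; rw [hφ]⟩))
  naturality U V f := by
    ext z
    induction z using Quotient.inductionOn' with
    | h z =>
      exact congrArg (Quotient.mk (contractSetoid P' L V))
        (Prod.ext (NatTrans.naturality_apply φ.hom f z.1) rfl)

/-- Isomorphic torsors have isomorphic contracted products. -/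
theorem contractTorsor_congr {P P' : Torsor A} (h : P.Isomorphic P') :
    (contractTorsor P L).Isomorphic (contractTorsor P' L) := by
  obtain ⟨φ, hφ⟩ := h
  have e1 : ∀ U x, φ.inv.hom.app U (φ.hom.hom.app U x) = x := fun U x =>
    congr(($(φ.hom_inv_id)).hom.app U x)
  have e2 : ∀ U x, φ.hom.hom.app U (φ.inv.hom.app U x) = x := fun U x =>
    congr(($(φ.inv_hom_id)).hom.app U x)
  have hψ : ∀ (U : 𝒞ᵒᵖ) (p : P'.carrier.obj.obj U) (a : A.obj.obj U),
      φ.inv.hom.app U (P'.act p a) = P.act (φ.inv.hom.app U p) a := fun U q a => by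
    rw [← e1 U (P.act _ a), hφ, e2]
  let ι : contractPresheaf P L.toLeftAction ≅ contractPresheaf P' L.toLeftAction :=
    { hom := contractPresheafMap L.toLeftAction φ.hom hφ
      inv := contractPresheafMap L.toLeftAction φ.inv hψ
      hom_inv_id := by
        ext U z
        obtain ⟨z, rfl⟩ := Quotient.exists_rep z
        exact congrArg (Quotient.mk (contractSetoid P L.toLeftAction U))
          (Prod.ext (e1 U z.1) rfl)
      inv_hom_id := by
        ext U z
        obtain ⟨z, rfl⟩ := Quotient.exists_rep z
        exact congrArg (Quotient.mk (contractSetoid P' L.toLeftAction U))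
          (Prod.ext (e2 U z.1) rfl) }
  let κ : contract P L.toLeftAction ≅ contract P' L.toLeftAction :=
    (presheafToSheaf J (Type (max u v))).mapIso ι
  have hκ : ∀ (U : 𝒞ᵒᵖ) (p : P.carrier.obj.obj U) (x : X.carrier.obj.obj U),
      κ.hom.hom.app U (cls P L.toLeftAction p x) =
        cls P' L.toLeftAction (φ.hom.hom.app U p) x := by
    intro U p x
    have := congr(($(toSheafify_naturality J ι.hom)).app U (contractMk P L.toLeftAction p x))
    exact this.symm
  have key : ∀ (U : 𝒞) (q : (contract P L.toLeftAction).obj.obj (op U)) (h : H.obj.obj (op U)),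
      κ.hom.hom.app (op U) (contractAct P L q h) =
        contractAct P' L (κ.hom.hom.app (op U) q) h := by
    intro U q h
    obtain ⟨S, hS, hS'⟩ := locally_cls P L.toLeftAction q
    refine sheaf_ext _ hS fun V f hf => ?_
    obtain ⟨p, x, e⟩ := hS' f hf
    rw [map_contractAct, ← NatTrans.naturality_apply, ← NatTrans.naturality_apply,
      map_contractAct, e, cls_contractAct, hκ, hκ, cls_contractAct]
  exact ⟨κ, fun U q h => key U.unop q h⟩

end ContractTorsor

/-! ## Exact sequences, push-forward, the action of `C` on `H¹(A)`, and twists -/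

section Exact

variable {A B C : Sheaf J GrpCat.{max u v}}

/-- `1 → A → B → C → 1` is a central exact sequence of sheaves of groups: `i` identifies `A` with
the kernel of `π`, `π` is an epimorphism of sheaves (every section of `C` lifts locally to `B`),
and the image of `A` lies in the centre of `B`. -/
structure IsCentralExact (i : A ⟶ B) (π : B ⟶ C) : Prop where
  injective : ∀ U : 𝒞ᵒᵖ, Function.Injective (i.hom.app U)
  exact : ∀ (U : 𝒞ᵒᵖ) (b : B.obj.obj U), π.hom.app U b = 1 ↔ ∃ a, i.hom.app U a = b
  surjective : Presheaf.IsLocallySurjective J π.hom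
  central : ∀ (U : 𝒞ᵒᵖ) (a : A.obj.obj U) (b : B.obj.obj U),
    i.hom.app U a * b = b * i.hom.app U a

/-- The trivial torsor: `G` acting on itself by right translations. -/
noncomputable def trivialTorsor (G : Sheaf J GrpCat.{max u v}) : Torsor G where
  carrier := setSheaf G
  act {U} p g := (grp p) * g
  act_one {U} p := mul_one (M := G.obj.obj U) p
  act_mul {U} p g h := (mul_assoc (G := G.obj.obj U) p g h).symm
  map_act {U V} f p g := map_mul (G.obj.map f).hom (grp p) g
  bijective U := by
    constructor
    · rintro ⟨p, g⟩ ⟨p', g'⟩ e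
      obtain ⟨rfl, e⟩ := Prod.mk.inj e
      exact Prod.ext rfl (mul_left_cancel (G := G.obj.obj U) e)
    · rintro ⟨p, q⟩
      exact ⟨(p, (grp p)⁻¹ * (grp q)),
        Prod.ext rfl (mul_inv_cancel_left (G := G.obj.obj U) p q)⟩
  locally_nonempty U := ⟨⊤, J.top_mem U, fun V _ _ => ⟨(1 : G.obj.obj (op V))⟩⟩

/-- `A` acting on `B` by left translations through `i : A ⟶ B`. -/
noncomputable def translationAction (i : A ⟶ B) : CommutingAction A (trivialTorsor B) where
  smul {U} a b := i.hom.app U a * (grp b)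
  one_smul {U} b := by
    rw [map_one]
    exact one_mul (M := B.obj.obj U) b
  mul_smul {U} a a' b := by
    rw [map_mul]
    exact mul_assoc (G := B.obj.obj U) _ _ _
  map_smul {U V} f a b := by
    refine (map_mul (B.obj.map f).hom (i.hom.app U a) (grp b)).trans ?_
    exact congrArg (· * B.obj.map f (grp b))
      (NatTrans.naturality_apply i.hom f a).symm
  smul_act {U} a b b' := (mul_assoc (G := B.obj.obj U) _ _ _).symm

/-- The push-forward `i_* : H¹(A) → H¹(B)`, `[P] ↦ [P ∧^A B]`. -/
noncomputable def H1.map (i : A ⟶ B) : H1 A → H1 B :=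
  Quotient.map (fun P => contractTorsor P (translationAction i))
    (fun _ _ h => contractTorsor_congr (translationAction i) h)

/-- The conjugation action of `A` on `B` through `i : A ⟶ B`. -/
noncomputable def conjAction (i : A ⟶ B) : LeftAction A (setSheaf B) where
  smul {U} a b := i.hom.app U a * (grp b) * (i.hom.app U a)⁻¹
  one_smul {U} b := by
    rw [map_one, inv_one]
    exact (mul_one (M := B.obj.obj U) _).trans (one_mul (M := B.obj.obj U) b)
  mul_smul {U} a a' b := by
    have m : ∀ x y b : B.obj.obj U, x * y * b * (x * y)⁻¹ = x * (y * b * y⁻¹) * x⁻¹ := by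
      intro x y b
      group
    rw [map_mul]
    exact m _ _ (grp b)
  map_smul {U V} f a b := by
    have n := NatTrans.naturality_apply i.hom f a
    have m : B.obj.map f (i.hom.app U a * (grp b) * (i.hom.app U a)⁻¹) =
        i.hom.app V (A.obj.map f a) * B.obj.map f (grp b) *
          (i.hom.app V (A.obj.map f a))⁻¹ := by
      rw [map_mul, map_mul, map_inv, n]
    exact m

/-- The twist `^P B` of `B` by an `A`-torsor `P`: the quotient sheaf of `P × B` by
`(p, b) ∼ (p a⁻¹, a b a⁻¹)`. -/
noncomputable def twist (i : A ⟶ B) (P : Torsor A) : Sheaf J (Type (max u v)) :=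
  contract P (conjAction i)

variable {i : A ⟶ B} {π : B ⟶ C}

theorem IsCentralExact.comp_eq_one (E : IsCentralExact i π) {U : 𝒞ᵒᵖ} (a : A.obj.obj U) :
    π.hom.app U (i.hom.app U a) = 1 := (E.exact U _).2 ⟨a, rfl⟩

theorem IsCentralExact.map_conj (E : IsCentralExact i π) {U : 𝒞ᵒᵖ} (a : A.obj.obj U)
    (b : B.obj.obj U) :
    π.hom.app U (i.hom.app U a * b * (i.hom.app U a)⁻¹) = π.hom.app U b := by
  rw [map_mul, map_mul, map_inv, E.comp_eq_one, one_mul, inv_one, mul_one]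

/-- The map `[p, b] ↦ π b` on the quotient presheaf. -/
noncomputable def twistPreProj (E : IsCentralExact i π) (P : Torsor A) :
    contractPresheaf P (conjAction i) ⟶ (setSheaf C).obj where
  app U := TypeCat.ofHom (Quotient.lift (s := contractSetoid P (conjAction i) U)
    (fun z => π.hom.app U (grp z.2)) (by
      rintro z w ⟨a, rfl⟩
      exact (E.map_conj a⁻¹ (grp z.2)).symm))
  naturality U V f := by
    ext z
    obtain ⟨z, rfl⟩ := Quotient.exists_rep z
    exact NatTrans.naturality_apply π.hom f (grp z.2)

/-- The quotient map `^P B → C`, `[p, b] ↦ π b`. -/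
noncomputable def twistProj (E : IsCentralExact i π) (P : Torsor A) :
    twist i P ⟶ setSheaf C :=
  ⟨sheafifyLift J (twistPreProj E P) (setSheaf C).2⟩

theorem twistProj_cls (E : IsCentralExact i π) (P : Torsor A) {U : 𝒞ᵒᵖ}
    (p : P.carrier.obj.obj U) (b : B.obj.obj U) :
    (twistProj E P).hom.app U (cls P (conjAction i) p b) = π.hom.app U b :=
  congr(($(toSheafify_sheafifyLift J (twistPreProj E P) (setSheaf C).2)).app U
    (contractMk P (conjAction i) p b))

section Preimage

variable {t : 𝒞} (ht : Limits.IsTerminal t) (π) (c : C.obj.obj (op t))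

/-- The preimage of a global section `c` of `C` in `B`, as a subfunctor of `B`. -/
noncomputable def preimageSubfunctor : Subfunctor (setSheaf B).obj where
  obj U := {b | π.hom.app U (grp b) = C.obj.map (ht.from U.unop).op c}
  map {U V} f b hb := by
    have n := NatTrans.naturality_apply π.hom f (grp b)
    change π.hom.app V (B.obj.map f (grp b)) = _
    rw [n, show π.hom.app U (grp b) = _ from hb, ← Functor.map_comp_apply]
    congr 3
    exact Quiver.Hom.unop_inj (ht.hom_ext _ _)

/-- The preimage sheaf. -/
noncomputable def preimage : Sheaf J (Type (max u v)) :=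
  ⟨(preimageSubfunctor π ht c).toFunctor, by
    have hB := (isSheaf_iff_isSheaf_of_type J _).1 (setSheaf B).2
    rw [isSheaf_iff_isSheaf_of_type, Subfunctor.isSheaf_iff _ hB]
    intro U b hb
    refine sheaf_ext (setSheaf C) hb fun V f hf => ?_
    have h1 : π.hom.app (op V) (B.obj.map f.op (grp b)) =
      C.obj.map (ht.from V).op c := hf
    have n := NatTrans.naturality_apply π.hom f.op (grp b)
    change C.obj.map f.op (π.hom.app U (grp b)) =
      C.obj.map f.op (C.obj.map (ht.from U.unop).op c)
    rw [← Functor.map_comp_apply, ← op_comp, ht.hom_ext (f ≫ ht.from U.unop) (ht.from V), ← h1]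
    exact n.symm⟩

variable {π} (E : IsCentralExact i π)

/-- The preimage of `c` in `B` as a right `A`-torsor, with action `b · a = b i(a)`. -/
noncomputable def preimageTorsor : Torsor A where
  carrier := preimage π ht c
  act {U} b a := ⟨(grp b.1) * i.hom.app U a, by
    have h : π.hom.app U (grp b.1) = _ := b.2
    change π.hom.app U ((grp b.1) * i.hom.app U a) = _
    rw [map_mul, E.comp_eq_one, mul_one, h]⟩
  act_one {U} b := Subtype.ext (by
    change (grp b.1) * i.hom.app U 1 = _
    rw [map_one]
    exact mul_one (M := B.obj.obj U) _)
  act_mul {U} b g h := Subtype.ext (by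
    change (grp b.1) * i.hom.app U (g * h) = _
    rw [map_mul]
    exact (mul_assoc (G := B.obj.obj U) _ _ _).symm)
  map_act {U V} f b a := Subtype.ext (by
    change B.obj.map f ((grp b.1) * i.hom.app U a) =
      B.obj.map f (grp b.1) * i.hom.app V (A.obj.map f a)
    rw [map_mul]
    exact congrArg _ (NatTrans.naturality_apply i.hom f a).symm)
  bijective U := by
    constructor
    · rintro ⟨b, a⟩ ⟨b', a'⟩ e
      obtain ⟨rfl, e⟩ := Prod.mk.inj e
      have e' : (grp b.1) * i.hom.app U a =
        (grp b.1) * i.hom.app U a' := congrArg Subtype.val e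
      exact Prod.ext rfl (E.injective U (mul_left_cancel e'))
    · rintro ⟨b, b'⟩
      have h : π.hom.app U (grp b.1) = _ := b.2
      have h' : π.hom.app U (grp b'.1) = _ := b'.2
      obtain ⟨a, ha⟩ := (E.exact U
        ((grp b.1)⁻¹ * (grp b'.1))).1 (by
          rw [map_mul, map_inv, h, h', inv_mul_cancel])
      refine ⟨(b, a), Prod.ext rfl (Subtype.ext ?_)⟩
      change (grp b.1) * i.hom.app U a = _
      rw [ha]
      exact mul_inv_cancel_left (G := B.obj.obj U) _ _
  locally_nonempty U := by
    have := E.surjective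
    refine ⟨_, Presheaf.imageSieve_mem J π.hom (U := op U) (C.obj.map (ht.from U).op c),
      fun V f hf => ?_⟩
    obtain ⟨b, hb⟩ := hf
    refine ⟨⟨b, ?_⟩⟩
    refine hb.trans ?_
    rw [← Functor.map_comp_apply, ← op_comp, ht.hom_ext (f ≫ ht.from U) (ht.from V)]

/-- The left action `a · b = i(a) b` of `A` on the preimage of `c` in `B`, which makes it an
`A`-bitorsor. -/
noncomputable def preimageAction : CommutingAction A (preimageTorsor ht c E) where
  smul {U} a b := ⟨i.hom.app U a * (grp b.1), by
    have h : π.hom.app U (grp b.1) = _ := b.2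
    change π.hom.app U (i.hom.app U a * (grp b.1)) = _
    rw [map_mul, E.comp_eq_one, one_mul, h]⟩
  one_smul {U} b := Subtype.ext (by
    change i.hom.app U 1 * (grp b.1) = _
    rw [map_one]
    exact one_mul (M := B.obj.obj U) _)
  mul_smul {U} a a' b := Subtype.ext (by
    change i.hom.app U (a * a') * (grp b.1) = _
    rw [map_mul]
    exact mul_assoc (G := B.obj.obj U) _ _ _)
  map_smul {U V} f a b := Subtype.ext (by
    change B.obj.map f (i.hom.app U a * (grp b.1)) =
      i.hom.app V (A.obj.map f a) * B.obj.map f (grp b.1)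
    rw [map_mul]
    exact congrArg (· * B.obj.map f (grp b.1))
      (NatTrans.naturality_apply i.hom f a).symm)
  smul_act {U} a b a' := Subtype.ext (mul_assoc (G := B.obj.obj U) _ _ _).symm

/-- The operation of a global section `c` of `C` on `H¹(A)`: `c * [P] = [P ∧^A X]` with `X` the
preimage of `c` in `B`. -/
noncomputable def H1.act : H1 A → H1 A :=
  Quotient.map (fun P => contractTorsor P (preimageAction ht c E))
    (fun _ _ h => contractTorsor_congr (preimageAction ht c E) h)

end Preimage

end Exact

end Site

/-! ## Group schemes and the fppf topology -/

section Scheme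

open AlgebraicGeometry

/-- The fppf topology on the category of schemes over `S`. -/
noncomputable abbrev fppf (S : Scheme.{u}) : GrothendieckTopology (Over S) :=
  Scheme.fppfTopology.over S

/-- The fppf sheaf of groups `T ↦ G(T)` of a group scheme over `S`. -/
noncomputable def fppfSheaf (S : Scheme.{u}) :
    Grp (Over S) ⥤ Sheaf (fppf S) GrpCat.{u + 1} where
  obj G := ⟨yonedaGrpObj G.X ⋙ GrpCat.uliftFunctor.{u + 1, u}, by
    rw [Presheaf.isSheaf_iff_isSheaf_forget _ _ (forget GrpCat), isSheaf_iff_isSheaf_of_type]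
    exact Presieve.isSheaf_comp_uliftFunctor _ (P := yoneda.obj G.X)
      (GrothendieckTopology.Subcanonical.isSheaf_of_isRepresentable _)⟩
  map f := ⟨Functor.whiskerRight (yonedaGrp.map f) GrpCat.uliftFunctor.{u + 1, u}⟩
  map_id G := by
    ext : 1
    change Functor.whiskerRight (yonedaGrp.map (𝟙 G)) _ = _
    rw [yonedaGrp.map_id]
    rfl
  map_comp f g := by
    ext : 1
    change Functor.whiskerRight (yonedaGrp.map (f ≫ g)) _ = _
    rw [yonedaGrp.map_comp]
    rfl

/-- The group `G(R)` of sections of a sheaf of groups on the fppf site of `S` over `S` itself. -/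
abbrev globalSections {S : Scheme.{u}} (G : Sheaf (fppf S) GrpCat.{u + 1}) : Type (u + 1) :=
  G.obj.obj (op (Over.mk (𝟙 S)))

end Scheme

end FlatCoh

open AlgebraicGeometry FlatCoh

/-!
The argument takes place over a site with a terminal object `t`, for a central exact sequence
`1 → A → B → C → 1` of sheaves of groups. All three conditions are equivalent to
surjectivity of `B(t) → C(t)`. Since `A` is central, it acts trivially on `B` by conjugation.
A section `b` of `B` therefore gives a section `[p, b]` of any twist `^P B`, independent of the local
choice of `p`, and `^P B → C` and `B → C` have the same image on sections
(`twistProj_surjective_iff`). The remaining implications are as follows.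

* `[p, x] ↦ [p, x]` is an equivariant map `P ∧^A π⁻¹(c) → P ∧^A B`, so `c * [P]` and `[P]` have the
  same push-forward (`H1.map_act`). If `i_*` is injective, the action is trivial.
* If `c` fixes the class of the trivial torsor, then `A ∧^A π⁻¹(c) ≅ π⁻¹(c)` has a global section,
  which lifts `c` to `B` (`exists_lift_of_act_trivial`).
* Let `Φ : P ∧^A B ≅ Q ∧^A B` be an isomorphism of `B`-torsors. Writing locally
  `Φ [p, 1] = [q, 1] b`, the section `π b` does not depend on `p` and `q`, so it defines a global
  section `c` of `C` (`exists_obstruction`). If `c` lifts to a global section `b₀` of `B`, then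
  `Φ [p, 1] = [q, 1] b₀` determines an `A`-equivariant map `p ↦ q` from `P` to `Q`
  (`H1.map_injective_of_surjective`).

Maps are glued with `exists_hom_of_rel`, and maps out of contracted products are given by
`exists_contract_desc`.
-/

namespace FlatCoh

section Site

variable {𝒞 : Type u} [Category.{v} 𝒞] {J : GrothendieckTopology 𝒞}

/-! ### Morphisms of sheaves of sets given by local data -/

/-- A relation between two sheaves of sets which is local, functional, and locally total is the
graph of a morphism of sheaves. -/
theorem exists_hom_of_rel (F G : Sheaf J (Type (max u v)))
    (r : ∀ ⦃U : 𝒞⦄, F.obj.obj (op U) → G.obj.obj (op U) → Prop)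
    (map : ∀ ⦃U V : 𝒞⦄ (f : V ⟶ U) (x : F.obj.obj (op U)) (y : G.obj.obj (op U)),
      r x y → r (F.obj.map f.op x) (G.obj.map f.op y))
    (unique : ∀ ⦃U : 𝒞⦄ (x : F.obj.obj (op U)) (y y' : G.obj.obj (op U)),
      r x y → r x y' → y = y')
    (of_locally : ∀ ⦃U : 𝒞⦄ (S : Sieve U), S ∈ J U →
      ∀ (x : F.obj.obj (op U)) (y : G.obj.obj (op U)),
      (∀ ⦃V : 𝒞⦄ (f : V ⟶ U), S f → r (F.obj.map f.op x) (G.obj.map f.op y)) → r x y)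
    (exists_locally : ∀ ⦃U : 𝒞⦄ (x : F.obj.obj (op U)), ∃ S ∈ J U, ∀ ⦃V : 𝒞⦄ (f : V ⟶ U), S f →
      ∃ y, r (F.obj.map f.op x) y) :
    ∃ φ : F ⟶ G, ∀ (U : 𝒞) (x : F.obj.obj (op U)), r x (φ.hom.app (op U) x) := by
  have total : ∀ (U : 𝒞) (x : F.obj.obj (op U)), ∃ y, r x y := by
    intro U x
    obtain ⟨S, hS, hS'⟩ := exists_locally x
    choose y hy using hS'
    have hc : Presieve.FamilyOfElements.Compatible (P := G.obj)
        (R := S.arrows) (fun V f hf => y f hf) := by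
      intro V₁ V₂ W g₁ g₂ f₁ f₂ h₁ h₂ e
      have t₁ := map g₁ _ _ (hy f₁ h₁)
      have t₂ := map g₂ _ _ (hy f₂ h₂)
      simp only [← Functor.map_comp_apply, ← op_comp] at t₁ t₂
      rw [← e] at t₂
      exact unique _ _ _ t₁ t₂
    obtain ⟨z, hz, -⟩ := ((isSheaf_iff_isSheaf_of_type J _).1 G.2) S hS _ hc
    refine ⟨z, of_locally S hS _ _ fun V f hf => ?_⟩
    rw [hz f hf]
    exact hy f hf
  choose m hm using total
  refine ⟨⟨{ app := fun U => TypeCat.ofHom (m U.unop), naturality := ?_ }⟩, hm⟩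
  intro U V f
  ext x
  exact unique _ _ _ (hm V.unop _) (map f.unop _ _ (hm U.unop x))

/-- The universal property of the contracted product: a balanced natural pairing
`P × X → F` factors through `P ∧^A X`. -/
theorem exists_contract_desc {A : Sheaf J GrpCat.{max u v}} (P : Torsor A)
    {X : Sheaf J (Type (max u v))} (L : LeftAction A X) (F : Sheaf J (Type (max u v)))
    (g : ∀ {U : 𝒞ᵒᵖ}, P.carrier.obj.obj U → X.obj.obj U → F.obj.obj U)
    (map : ∀ {U V : 𝒞ᵒᵖ} (f : U ⟶ V) (p : P.carrier.obj.obj U) (x : X.obj.obj U),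
      F.obj.map f (g p x) = g (P.carrier.obj.map f p) (X.obj.map f x))
    (balanced : ∀ {U : 𝒞ᵒᵖ} (p : P.carrier.obj.obj U) (a : A.obj.obj U) (x : X.obj.obj U),
      g (P.act p a) x = g p (L.smul a x)) :
    ∃ φ : contract P L ⟶ F, ∀ (U : 𝒞ᵒᵖ) (p : P.carrier.obj.obj U) (x : X.obj.obj U),
      φ.hom.app U (cls P L p x) = g p x := by
  let ψ : contractPresheaf P L ⟶ F.obj :=
    { app := fun U => TypeCat.ofHom (Quotient.lift (s := contractSetoid P L U)
        (fun z => g z.1 z.2) (by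
          rintro z w ⟨a, rfl⟩
          dsimp only
          rw [balanced, ← L.mul_smul, mul_inv_cancel, L.one_smul]))
      naturality := fun U V f => by
        ext z
        obtain ⟨z, rfl⟩ := Quotient.exists_rep z
        exact (map f z.1 z.2).symm }
  exact ⟨⟨sheafifyLift J ψ F.2⟩, fun U p x =>
    congr(($(toSheafify_sheafifyLift J ψ F.2)).app U (contractMk P L p x))⟩

/-! ### Equivariant morphisms of torsors -/

/-- An equivariant morphism of torsors is an isomorphism. -/
theorem Torsor.isomorphic_of_equivariant {G : Sheaf J GrpCat.{max u v}} {P Q : Torsor G}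
    (φ : P.carrier ⟶ Q.carrier)
    (hφ : ∀ (U : 𝒞) (p : P.carrier.obj.obj (op U)) (g : G.obj.obj (op U)),
      φ.hom.app (op U) (P.act p g) = Q.act (φ.hom.app (op U) p) g) :
    P.Isomorphic Q := by
  have inj : ∀ (U : 𝒞) (p p' : P.carrier.obj.obj (op U)),
      φ.hom.app (op U) p = φ.hom.app (op U) p' → p = p' := by
    intro U p p' e
    obtain ⟨g, rfl⟩ := P.exists_act_eq p p'
    rw [hφ] at e
    have hg : (1 : G.obj.obj (op U)) = g := Q.eq_of_act_eq ((Q.act_one _).trans e)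
    rw [← hg, P.act_one]
  obtain ⟨ψ, hψ⟩ := exists_hom_of_rel Q.carrier P.carrier
    (fun U q p => φ.hom.app (op U) p = q)
    (fun U V f q p e => by rw [NatTrans.naturality_apply, e])
    (fun U q p p' e e' => inj U p p' (e.trans e'.symm))
    (fun U S hS q p h => sheaf_ext _ hS fun V f hf => by
      rw [← NatTrans.naturality_apply]
      exact h f hf)
    (fun U q => by
      obtain ⟨S, hS, hS'⟩ := P.locally_nonempty U
      refine ⟨S, hS, fun V f hf => ?_⟩
      obtain ⟨p⟩ := hS' f hf
      obtain ⟨g, hg⟩ := Q.exists_act_eq (φ.hom.app (op V) p) (Q.carrier.obj.map f.op q)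
      exact ⟨P.act p g, by rw [hφ, hg]⟩)
  refine ⟨⟨φ, ψ, ?_, ?_⟩, fun U p g => hφ U.unop p g⟩
  · ext U p
    exact inj U.unop _ _ (hψ U.unop _)
  · ext U q
    exact hψ U.unop q

/-- Equivariance of a morphism out of a contracted product can be checked on the classes
`[p, x]`. -/
theorem contract_equivariant {A H K : Sheaf J GrpCat.{max u v}} (P : Torsor A) {X : Torsor H}
    (L : CommutingAction A X) (j : H ⟶ K) {Y : Torsor K}
    (φ : contract P L.toLeftAction ⟶ Y.carrier)
    (hφ : ∀ (U : 𝒞) (p : P.carrier.obj.obj (op U)) (x : X.carrier.obj.obj (op U))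
      (h : H.obj.obj (op U)), φ.hom.app (op U) (cls P L.toLeftAction p (X.act x h)) =
        Y.act (φ.hom.app (op U) (cls P L.toLeftAction p x)) (j.hom.app (op U) h))
    (U : 𝒞ᵒᵖ) (q : (contract P L.toLeftAction).obj.obj U) (h : H.obj.obj U) :
    φ.hom.app U (contractAct P L q h) = Y.act (φ.hom.app U q) (j.hom.app U h) := by
  obtain ⟨S, hS, hS'⟩ := locally_cls P L.toLeftAction (U := U.unop) q
  refine sheaf_ext _ hS fun V k hk => ?_
  obtain ⟨p, x, e⟩ := hS' k hk
  rw [← NatTrans.naturality_apply, map_contractAct, e, cls_contractAct, hφ, Y.map_act,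
    ← NatTrans.naturality_apply, e, ← NatTrans.naturality_apply]

section PushForward

variable {A B : Sheaf J GrpCat.{max u v}} (i : A ⟶ B)

/-- An `i`-equivariant morphism from an `A`-torsor `T` to a `B`-torsor `Y` exhibits `Y` as the
push-forward of `T` along `i`. -/
theorem pushforward_isomorphic {T : Torsor A} {Y : Torsor B} (f : T.carrier ⟶ Y.carrier)
    (hf : ∀ (U : 𝒞ᵒᵖ) (p : T.carrier.obj.obj U) (a : A.obj.obj U),
      f.hom.app U (T.act p a) = Y.act (f.hom.app U p) (i.hom.app U a)) :
    (contractTorsor T (translationAction i)).Isomorphic Y := by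
  obtain ⟨φ, hφ⟩ := exists_contract_desc T (translationAction i).toLeftAction Y.carrier
    (fun {U} p b => Y.act (f.hom.app U p) (grp b))
    (fun {U V} k p b => by
      rw [Y.map_act, ← NatTrans.naturality_apply]
      rfl)
    (fun {U} p a b => by
      rw [hf, ← Y.act_mul]
      rfl)
  refine Torsor.isomorphic_of_equivariant φ fun U q b => ?_
  refine contract_equivariant T (translationAction i) (𝟙 B) φ (fun V p x b => ?_) (op U) q b
  rw [hφ, hφ, ← Y.act_mul]
  rfl

/-- The section `[p, 1]` of the push-forward `P ∧^A B` attached to a section `p` of `P`. -/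
noncomputable def pushforwardMk (P : Torsor A) {U : 𝒞ᵒᵖ} (p : P.carrier.obj.obj U) :
    (contractTorsor P (translationAction i)).carrier.obj.obj U :=
  cls P (translationAction i).toLeftAction p (1 : B.obj.obj U)

theorem map_pushforwardMk (P : Torsor A) {U V : 𝒞ᵒᵖ} (f : U ⟶ V) (p : P.carrier.obj.obj U) :
    (contractTorsor P (translationAction i)).carrier.obj.map f (pushforwardMk i P p) =
      pushforwardMk i P (P.carrier.obj.map f p) := by
  refine (map_cls P (translationAction i).toLeftAction f p _).trans ?_
  exact congrArg (cls P (translationAction i).toLeftAction _) (map_one (B.obj.map f).hom)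

theorem cls_eq_act_pushforwardMk (P : Torsor A) {U : 𝒞ᵒᵖ} (p : P.carrier.obj.obj U)
    (b : B.obj.obj U) :
    cls P (translationAction i).toLeftAction p b =
      (contractTorsor P (translationAction i)).act (pushforwardMk i P p) b := by
  refine Eq.trans ?_ (cls_contractAct P (translationAction i) p _ b).symm
  exact congrArg (cls P (translationAction i).toLeftAction p) (one_mul (M := B.obj.obj U) b).symm

theorem pushforwardMk_act (P : Torsor A) {U : 𝒞ᵒᵖ} (p : P.carrier.obj.obj U)
    (a : A.obj.obj U) :
    pushforwardMk i P (P.act p a) =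
      (contractTorsor P (translationAction i)).act (pushforwardMk i P p) (i.hom.app U a) := by
  rw [← cls_eq_act_pushforwardMk]
  refine (cls_act_smul P (translationAction i).toLeftAction p a _).trans ?_
  exact congrArg (cls P (translationAction i).toLeftAction p)
    (mul_one (M := B.obj.obj U) (i.hom.app U a))

end PushForward

end Site


section Exact

variable {𝒞 : Type u} [Category.{v} 𝒞] {J : GrothendieckTopology 𝒞}
  {A B C : Sheaf J GrpCat.{max u v}} {i : A ⟶ B} {π : B ⟶ C}
  (E : IsCentralExact i π) {t : 𝒞} (ht : Limits.IsTerminal t)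

/-! ### Lifting global sections and the twists -/

/-- Conjugation by a central subgroup is trivial. -/
theorem IsCentralExact.conj_smul (E : IsCentralExact i π) {U : 𝒞ᵒᵖ} (a : A.obj.obj U)
    (b : (setSheaf B).obj.obj U) : (conjAction i).smul a b = b := by
  change i.hom.app U a * (grp b) * (i.hom.app U a)⁻¹ = _
  rw [E.central, mul_inv_cancel_right]

/-- As `A` acts trivially on `B` by conjugation, every section of `B` defines a section of the
twist `^P B` with the same image in `C`. -/
theorem exists_twist_section (P : Torsor A) {U : 𝒞} (b : B.obj.obj (op U)) :
    ∃ y : (twist i P).obj.obj (op U), (twistProj E P).hom.app (op U) y = π.hom.app (op U) b := by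
  -- `[p, b]` does not depend on `p`, so the local sections `[p, b]` glue.
  obtain ⟨φ, hφ⟩ := exists_hom_of_rel (setSheaf B) (twist i P)
    (fun U b y => ∀ ⦃V : 𝒞⦄ (f : V ⟶ U) (p : P.carrier.obj.obj (op V)),
      (twist i P).obj.map f.op y = cls P (conjAction i) p ((setSheaf B).obj.map f.op b))
    (fun U V f b y h W g p => by
      simpa using h (g ≫ f) p)
    (fun U b y y' h h' => by
      obtain ⟨S, hS, hS'⟩ := P.locally_nonempty U
      refine sheaf_ext _ hS fun V f hf => ?_
      obtain ⟨p⟩ := hS' f hf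
      rw [h f p, h' f p])
    (fun U S hS b y h V f p => by
      refine sheaf_ext _ (J.pullback_stable f hS) fun W g hg => ?_
      have := h (g ≫ f) hg (𝟙 W) (P.carrier.obj.map g.op p)
      refine Eq.trans ?_ (map_cls P (conjAction i) g.op p _).symm
      simpa using this)
    (fun U b => by
      obtain ⟨S, hS, hS'⟩ := P.locally_nonempty U
      refine ⟨S, hS, fun V f hf => ?_⟩
      obtain ⟨p⟩ := hS' f hf
      refine ⟨cls P (conjAction i) p ((setSheaf B).obj.map f.op b), fun W g p' => ?_⟩
      obtain ⟨a, rfl⟩ := P.exists_act_eq (P.carrier.obj.map g.op p) p'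
      rw [cls_act_smul, E.conj_smul]
      exact map_cls P (conjAction i) g.op p _)
  refine ⟨φ.hom.app (op U) b, ?_⟩
  obtain ⟨S, hS, hS'⟩ := P.locally_nonempty U
  refine sheaf_ext (setSheaf C) hS fun V f hf => ?_
  obtain ⟨p⟩ := hS' f hf
  rw [← NatTrans.naturality_apply, hφ U b f p]
  exact (twistProj_cls E P p (B.obj.map f.op b)).trans (NatTrans.naturality_apply π.hom f.op b)

/-- Conversely, every section of the twist comes from a section of `B` with the same image
in `C`. -/
theorem exists_section_of_twist (P : Torsor A) {U : 𝒞} (y : (twist i P).obj.obj (op U)) :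
    ∃ b : B.obj.obj (op U), π.hom.app (op U) b = (twistProj E P).hom.app (op U) y := by
  obtain ⟨φ, hφ⟩ := exists_contract_desc P (conjAction i) (setSheaf B) (fun _ b => b)
    (fun _ _ _ => rfl) (fun _ a b => (E.conj_smul a b).symm)
  refine ⟨φ.hom.app (op U) y, ?_⟩
  obtain ⟨S, hS, hS'⟩ := locally_cls P (conjAction i) y
  refine sheaf_ext (setSheaf C) hS fun V f hf => ?_
  obtain ⟨p, b, e⟩ := hS' f hf
  have h1 := NatTrans.naturality_apply (twistProj E P).hom f.op y
  have h2 := NatTrans.naturality_apply φ.hom f.op y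
  change φ.hom.app _ ((contract P (conjAction i)).obj.map f.op y) = _ at h2
  change (twistProj E P).hom.app _ ((contract P (conjAction i)).obj.map f.op y) = _ at h1
  rw [e, hφ] at h2
  rw [e] at h1
  rw [← (twistProj_cls E P p b).symm.trans h1, h2]
  exact (NatTrans.naturality_apply π.hom f.op (φ.hom.app (op U) y)).symm

theorem twistProj_surjective_iff (U : 𝒞) :
    (∀ P : Torsor A, Function.Surjective ((twistProj E P).hom.app (op U))) ↔
      Function.Surjective (π.hom.app (op U)) := by
  constructor
  · intro h c
    obtain ⟨y, hy⟩ := h (trivialTorsor A) c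
    obtain ⟨b, hb⟩ := exists_section_of_twist E _ y
    exact ⟨b, hb.trans hy⟩
  · intro h P c
    obtain ⟨b, hb⟩ := h c
    obtain ⟨y, hy⟩ := exists_twist_section E P b
    exact ⟨y, hy.trans hb⟩

/-! ### The action of global sections of `C` -/

/-- The action of `C` preserves the fibres of the push-forward. -/
theorem H1.map_act (c : C.obj.obj (op t)) (x : H1 A) :
    H1.map i (H1.act ht c E x) = H1.map i x := by
  induction x using Quotient.inductionOn with
  | h P =>
  refine Quotient.sound ?_
  -- `[p, x] ↦ [p, x]` maps `P ∧^A π⁻¹(c)` to `P ∧^A B`.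
  obtain ⟨φ, hφ⟩ := exists_contract_desc P (preimageAction ht c E).toLeftAction
    (contract P (translationAction i).toLeftAction)
    (fun {U} p x => cls P (translationAction i).toLeftAction p (grp x.1))
    (fun {U V} f p x => map_cls P (translationAction i).toLeftAction f p x.1)
    (fun {U} p a x => cls_act_smul P (translationAction i).toLeftAction p a x.1)
  refine pushforward_isomorphic i (T := contractTorsor P (preimageAction ht c E))
    (Y := contractTorsor P (translationAction i)) φ ?_
  refine contract_equivariant P (preimageAction ht c E) i
    (Y := contractTorsor P (translationAction i)) φ fun U p x a => ?_
  refine (hφ _ _ _).trans (Eq.trans ?_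
    (congrArg (fun z => contractAct P (translationAction i) z (i.hom.app (op U) a))
      (hφ _ p x)).symm)
  exact (cls_contractAct P (translationAction i) p _ _).symm

/-- If `c` fixes the class of the trivial torsor then `A ∧^A π⁻¹(c)` has a global section, and the
map `[a, x] ↦ a x` carries it to a lift of `c`. -/
theorem exists_lift_of_act_trivial (c : C.obj.obj (op t))
    (h : H1.act ht c E (Quotient.mk _ (trivialTorsor A)) = Quotient.mk _ (trivialTorsor A)) :
    ∃ b, π.hom.app (op t) b = c := by
  obtain ⟨φ, -⟩ := Quotient.exact h.symm
  obtain ⟨ψ, -⟩ := exists_contract_desc (trivialTorsor A) (preimageAction ht c E).toLeftAction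
    (preimage π ht c) (fun {U} a x => (preimageAction ht c E).smul (grp a) x)
    (fun {U V} f a x => (preimageAction ht c E).map_smul f _ _)
    (fun {U} a a' x => (preimageAction ht c E).mul_smul (grp a) a' x)
  let x := ψ.hom.app (op t) (φ.hom.hom.app (op t) (1 : A.obj.obj (op t)))
  refine ⟨x.1, x.2.trans ?_⟩
  rw [ht.hom_ext (ht.from (op t).unop) (𝟙 t)]
  simp

/-! ### Fibres of the push-forward -/

theorem pushforwardMk_injective (E : IsCentralExact i π) (P : Torsor A) {U : 𝒞}
    {p p' : P.carrier.obj.obj (op U)}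
    (e : pushforwardMk i P p = pushforwardMk i P p') : p = p' := by
  obtain ⟨a, rfl⟩ := P.exists_act_eq p p'
  rw [pushforwardMk_act] at e
  have h1 : (1 : B.obj.obj (op U)) = i.hom.app (op U) a :=
    Torsor.eq_of_act_eq _ ((Torsor.act_one _ _).trans e)
  have h2 : (1 : A.obj.obj (op U)) = a := E.injective _ ((map_one _).trans h1)
  rw [← h2, P.act_one]

/-- An isomorphism of push-forwards determines a global section of `C`, measuring the failure of
the isomorphism to come from one of `A`-torsors. -/
theorem exists_obstruction (E : IsCentralExact i π) {P Q : Torsor A}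
    (Φ : (contractTorsor P (translationAction i)).carrier ⟶
      (contractTorsor Q (translationAction i)).carrier)
    (hΦ : ∀ (U : 𝒞ᵒᵖ) (y : (contractTorsor P (translationAction i)).carrier.obj.obj U)
      (b : B.obj.obj U), Φ.hom.app U ((contractTorsor P (translationAction i)).act y b) =
        (contractTorsor Q (translationAction i)).act (Φ.hom.app U y) b) (t : 𝒞) :
    ∃ c : C.obj.obj (op t), ∀ ⦃V : 𝒞⦄ (f : V ⟶ t) (p : P.carrier.obj.obj (op V))
      (q : Q.carrier.obj.obj (op V)) (b : B.obj.obj (op V)),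
      Φ.hom.app (op V) (pushforwardMk i P p) =
        (contractTorsor Q (translationAction i)).act (pushforwardMk i Q q) b →
      π.hom.app (op V) b = C.obj.map f.op c := by
  have exists_b : ∀ (V : 𝒞) (p : P.carrier.obj.obj (op V)) (q : Q.carrier.obj.obj (op V)), ∃ b,
      Φ.hom.app (op V) (pushforwardMk i P p) =
        (contractTorsor Q (translationAction i)).act (pushforwardMk i Q q) b := fun V p q => by
    obtain ⟨b, hb⟩ := Torsor.exists_act_eq (contractTorsor Q (translationAction i))
      (pushforwardMk i Q q) (Φ.hom.app (op V) (pushforwardMk i P p))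
    exact ⟨b, hb.symm⟩
  -- The relation does not involve the section of the source sheaf; its morphism is constant.
  obtain ⟨φ, hφ⟩ := exists_hom_of_rel (setSheaf B) (setSheaf C)
    (fun U _ c => ∀ ⦃V : 𝒞⦄ (f : V ⟶ U) (p : P.carrier.obj.obj (op V))
      (q : Q.carrier.obj.obj (op V)) (b : B.obj.obj (op V)),
      Φ.hom.app (op V) (pushforwardMk i P p) =
        (contractTorsor Q (translationAction i)).act (pushforwardMk i Q q) b →
      π.hom.app (op V) b = C.obj.map f.op c)
    (fun U V f _ c h W g p q b e => by
      exact (h (g ≫ f) p q b e).trans (Functor.map_comp_apply C.obj f.op g.op c))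
    (fun U _ c c' h h' => by
      obtain ⟨S, hS, hS'⟩ := P.locally_nonempty U
      obtain ⟨T, hT, hT'⟩ := Q.locally_nonempty U
      refine sheaf_ext _ (J.intersection_covering hS hT) fun V f hf => ?_
      obtain ⟨p⟩ := hS' f hf.1
      obtain ⟨q⟩ := hT' f hf.2
      obtain ⟨b, hb⟩ := exists_b V p q
      exact (h f p q b hb).symm.trans (h' f p q b hb))
    (fun U S hS _ c h V f p q b e => by
      refine sheaf_ext (setSheaf C) (J.pullback_stable f hS) fun W g hg => ?_
      have e' := congrArg
        ((contractTorsor Q (translationAction i)).carrier.obj.map g.op) e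
      rw [← NatTrans.naturality_apply, map_pushforwardMk, Torsor.map_act, map_pushforwardMk] at e'
      have := h (g ≫ f) hg (𝟙 W) _ _ _ e'
      refine (NatTrans.naturality_apply π.hom g.op b).symm.trans (this.trans ?_)
      refine Eq.trans ?_ (Functor.map_comp_apply C.obj f.op g.op c)
      rw [op_id, C.obj.map_id]
      rfl)
    (fun U _ => by
      obtain ⟨S, hS, hS'⟩ := P.locally_nonempty U
      obtain ⟨T, hT, hT'⟩ := Q.locally_nonempty U
      refine ⟨_, J.intersection_covering hS hT, fun V f hf => ?_⟩
      obtain ⟨p⟩ := hS' f hf.1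
      obtain ⟨q⟩ := hT' f hf.2
      obtain ⟨b, hb⟩ := exists_b V p q
      refine ⟨π.hom.app (op V) b, fun W g p' q' b' e => ?_⟩
      obtain ⟨a, rfl⟩ := P.exists_act_eq (P.carrier.obj.map g.op p) p'
      obtain ⟨a', rfl⟩ := Q.exists_act_eq (Q.carrier.obj.map g.op q) q'
      have e' := congrArg
        ((contractTorsor Q (translationAction i)).carrier.obj.map g.op) hb
      rw [← NatTrans.naturality_apply, map_pushforwardMk, Torsor.map_act, map_pushforwardMk] at e'
      rw [pushforwardMk_act, pushforwardMk_act, hΦ, e', ← Torsor.act_mul, ← Torsor.act_mul] at e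
      have k := congrArg (π.hom.app (op W)) (Torsor.eq_of_act_eq _ e)
      rw [map_mul, map_mul, E.comp_eq_one, E.comp_eq_one, mul_one, one_mul] at k
      exact k.symm.trans (NatTrans.naturality_apply π.hom g.op b))
  exact ⟨φ.hom.app (op t) (1 : B.obj.obj (op t)), hφ t _⟩

/-- If every global section of `C` lifts to `B`, then torsors with isomorphic push-forwards are
isomorphic. -/
theorem H1.map_injective_of_surjective (E : IsCentralExact i π) (ht : Limits.IsTerminal t)
    (h : Function.Surjective (π.hom.app (op t))) :
    Function.Injective (H1.map i) := by
  intro x y e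
  induction x using Quotient.inductionOn with
  | h P =>
  induction y using Quotient.inductionOn with
  | h Q =>
  obtain ⟨Φ, hΦ⟩ := Quotient.exact e
  obtain ⟨c, hc⟩ := exists_obstruction E Φ.hom hΦ t
  obtain ⟨b₀, hb₀⟩ := h c
  have res : ∀ ⦃U V : 𝒞⦄ (f : V ⟶ U), B.obj.map f.op (B.obj.map (ht.from U).op b₀) =
      B.obj.map (ht.from V).op b₀ := fun U V f => by
    rw [← Functor.map_comp_apply, ← op_comp, ht.hom_ext (f ≫ ht.from U) (ht.from V)]
  -- Each `p` has a unique `q` with `Φ [p, 1] = [q, 1] b₀`.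
  obtain ⟨φ, hφ⟩ := exists_hom_of_rel P.carrier Q.carrier
    (fun U p q => Φ.hom.hom.app (op U) (pushforwardMk i P p) =
      (contractTorsor Q (translationAction i)).act (pushforwardMk i Q q)
        (B.obj.map (ht.from U).op b₀))
    (fun U V f p q e => by
      rw [← map_pushforwardMk, NatTrans.naturality_apply, e, Torsor.map_act, res,
        map_pushforwardMk])
    (fun U p q q' e e' => by
      refine pushforwardMk_injective E Q ?_
      have k := congrArg (fun z => (contractTorsor Q (translationAction i)).act z
        (B.obj.map (ht.from U).op b₀)⁻¹) (e.symm.trans e')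
      simpa only [← Torsor.act_mul, mul_inv_cancel, Torsor.act_one] using k)
    (fun U S hS p q k => by
      refine sheaf_ext _ hS fun V f hf => ?_
      rw [← NatTrans.naturality_apply, map_pushforwardMk, k f hf, Torsor.map_act, res,
        map_pushforwardMk])
    (fun U p => by
      obtain ⟨S, hS, hS'⟩ := Q.locally_nonempty U
      refine ⟨S, hS, fun V f hf => ?_⟩
      obtain ⟨q⟩ := hS' f hf
      obtain ⟨b, hb⟩ := Torsor.exists_act_eq (contractTorsor Q (translationAction i))
        (pushforwardMk i Q q) (Φ.hom.hom.app (op V) (pushforwardMk i P (P.carrier.obj.map f.op p)))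
      have k := hc (ht.from V) _ _ _ hb.symm
      obtain ⟨a, ha⟩ := (E.exact (op V) (b * (B.obj.map (ht.from V).op b₀)⁻¹)).1 (by
        rw [map_mul, map_inv, NatTrans.naturality_apply π.hom, hb₀, k, mul_inv_cancel])
      refine ⟨Q.act q a, ?_⟩
      rw [pushforwardMk_act, ← Torsor.act_mul, ha, inv_mul_cancel_right, hb])
  refine Quotient.sound (Torsor.isomorphic_of_equivariant φ fun U p a => ?_)
  refine pushforwardMk_injective E Q ?_
  have k := (hφ U (P.act p a)).symm
  rw [pushforwardMk_act, hΦ, hφ U p, ← Torsor.act_mul, ← E.central, Torsor.act_mul,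
    ← pushforwardMk_act] at k
  have k' := congrArg (fun z => (contractTorsor Q (translationAction i)).act z
    (B.obj.map (ht.from U).op b₀)⁻¹) k
  simpa only [← Torsor.act_mul, mul_inv_cancel, Torsor.act_one] using k'

/-- The equivalence over an arbitrary site with a terminal object. -/
theorem central_extension_tfae :
    List.TFAE [
      Function.Injective (H1.map i),
      ∀ P : Torsor A, Function.Surjective ((twistProj E P).hom.app (op t)),
      ∀ (c : C.obj.obj (op t)) (x : H1 A), H1.act ht c E x = x] := by
  rw [twistProj_surjective_iff]
  tfae_have 1 → 3 := fun h c x => h (H1.map_act E ht c x)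
  tfae_have 3 → 2 := fun h c => exists_lift_of_act_trivial E ht c (h c _)
  tfae_have 2 → 1 := H1.map_injective_of_surjective E ht
  tfae_finish

end Exact

end FlatCoh

theorem mainTheorem12 (R : Type u) [CommRing R]
    (A B C : Grp (Over (Spec (CommRingCat.of R))))
    (hA : Flat A.X.hom) (hB : Flat B.X.hom) (hC : Flat C.X.hom)
    (i : A ⟶ B) (π : B ⟶ C)
    (E : IsCentralExact ((fppfSheaf (Spec (CommRingCat.of R))).map i)
      ((fppfSheaf (Spec (CommRingCat.of R))).map π)) :
    List.TFAE [
      Function.Injective (H1.map ((fppfSheaf (Spec (CommRingCat.of R))).map i)),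
      ∀ P : FlatCoh.Torsor ((fppfSheaf (Spec (CommRingCat.of R))).obj A),
        Function.Surjective
          ((twistProj E P).hom.app (op (Over.mk (𝟙 (Spec (CommRingCat.of R)))))),
      ∀ (c : globalSections ((fppfSheaf (Spec (CommRingCat.of R))).obj C))
        (x : H1 ((fppfSheaf (Spec (CommRingCat.of R))).obj A)),
        H1.act Over.mkIdTerminal c E x = x] :=
  central_extension_tfae E Over.mkIdTerminal
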